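/- **Theorem 8.3.** Let $\mathcal X$ be the infinite Ginibre ensemble, i.e. the simple point process on $\mathbb C$ whose correlation functions with respect to Lebesgue measure are $\rho_k(z_1,\dots,z_k)=\det\big(\mathbb K(z_i,z_j)\big)_{1\le i,j\le k}$, $k\ge 1$, with $$\mathbb K(z,w)=\frac1\pi\, e^{-\frac12|z|^2-\frac12|w|^2+z\overline w}.$$ Here a point process is a random Borel measure $\mathcal X$ that is finite on compact sets and takes values in $\{0,1,2,\dots,\infty\}$; it is simple if almost surely all points have mass at most $1$; and $\rho_n\ge 0$, $n\ge1$, are its correlation functions if $\mathbf E\big[\prod_{i=1}^k\binom{\mathcal X(D_i)}{n_i}n_i!\big]=\int_{\prod_i D_i^{n_i}}\rho_n(z_1,\dots,z_n)\,dz_1\cdots dz_n$ for all disjoint Borel sets $D_1,\dots,D_k$ and all integers $n_1,\dots,n_k\ge0$ with $n=\sum_i n_i\ge1$. For $a\in\mathbb C$ and $r>0$ let $n_G(a,r)=\mathcal X(\{z:|z-a|<r\})$ be the number of points in the disk of radius $r$ around $a$. Then for every fixed $r>0$, $$\mathbf P\left[n_G(a,r)\ge m\right]=e^{-\frac12 m^2\log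 (m)\,(1+o(1))}\qquad(m\to\infty),$$ that is, there is a sequence $\varepsilon_m\to0$ depending only on $r$ such that $\mathbf P[n_G(a,r)\ge m]=e^{-\frac12m^2\log (m)(1+\varepsilon_m)}$ for all $m\ge2$ and all $a\in\mathbb C$. -/

import Mathlib

open MeasureTheory Filter Topology
open scoped ENNReal NNReal

/-- A point process on `E`: a random positive Borel
measure which is finite on compact sets and takes values in `ℕ ∪ {∞}`. Measurability of `X` is with
respect to the σ-algebra on measures generated by the evaluations `ν ↦ ν B`, `B` measurable. -/
structure IsPointProcess {Ω E : Type*} [MeasurableSpace Ω] [TopologicalSpace E] [MeasurableSpace E]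
    (X : Ω → Measure E) : Prop where
  measurable : Measurable X
  finite_on_compacts : ∀ ω, ∀ K : Set E, IsCompact K → X ω K < ∞
  integer_valued : ∀ ω, ∀ B : Set E, MeasurableSet B → ∃ n : ℕ∞, X ω B = (n : ℝ≥0∞)

/-- A random measure is simple if almost surely every singleton has mass at most `1`. -/
def IsSimplePointProcess {Ω E : Type*} [MeasurableSpace Ω] [MeasurableSpace E]
    (P : Measure Ω) (X : Ω → Measure E) : Prop :=
  ∀ᵐ ω ∂P, ∀ x : E, X ω {x} ≤ 1

/-- The falling factorial `x (x - 1) ⋯ (x - n + 1) = (x choose n) n!` for `x ∈ ℕ ∪ {∞}`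
(the subtraction is truncated, so the value is `0` when `x < n`). -/
noncomputable def fallingFactorial (x : ℝ≥0∞) (n : ℕ) : ℝ≥0∞ :=
  ∏ j ∈ Finset.range n, (x - (j : ℝ≥0∞))

theorem fallingFactorial_natCast (x n : ℕ) :
    fallingFactorial (x : ℝ≥0∞) n = (x.choose n * n.factorial : ℕ) := by
  rw [mul_comm, ← Nat.descFactorial_eq_factorial_mul_choose, fallingFactorial,
    Nat.descFactorial_eq_prod_range, Nat.cast_prod]
  simp

/-- The functions `ρ n : E ^ n → [0, ∞)`, `n ≥ 1`, are the correlation functions (joint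
intensities) of `X` with respect to `μ`: for disjoint Borel sets `D₁, …, D_k` and non-negative
integers `n₁, …, n_k` with sum `n ≥ 1`,
`𝔼 [∏ᵢ (X(Dᵢ) choose nᵢ) nᵢ!] = ∫_{∏ᵢ Dᵢ ^ nᵢ} ρ n dμ ⋯ dμ`.
The coordinates of `E ^ n` are grouped in `k` blocks of lengths `n₁, …, n_k`; both sides are
integrals of non-negative functions and may be infinite. -/
structure HasCorrelationFunctions {Ω E : Type*} [MeasurableSpace Ω] [MeasurableSpace E]
    (P : Measure Ω) (X : Ω → Measure E) (μ : Measure E)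
    (ρ : (n : ℕ) → (Fin n → E) → ℝ≥0) : Prop where
  measurable : ∀ n, 1 ≤ n → Measurable (ρ n)
  moments : ∀ (k : ℕ) (D : Fin k → Set E) (n : Fin k → ℕ),
    (∀ i, MeasurableSet (D i)) → Pairwise (fun i j => Disjoint (D i) (D j)) → 1 ≤ ∑ i, n i →
    ∫⁻ ω, ∏ i, fallingFactorial (X ω (D i)) (n i) ∂P
      = ∫⁻ x in {x : Fin (∑ i, n i) → E | ∀ i, ∀ j : Fin (n i), x (finSigmaFinEquiv ⟨i, j⟩) ∈ D i},
          (ρ (∑ i, n i) x : ℝ≥0∞) ∂(Measure.pi fun _ => μ)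

/-- `X` is a determinantal point process with kernel `K` with respect to the measure `μ`. -/
def IsDeterminantal {Ω E : Type*} [MeasurableSpace Ω] [TopologicalSpace E] [MeasurableSpace E]
    (P : Measure Ω) (X : Ω → Measure E) (μ : Measure E) (K : E → E → ℂ) : Prop :=
  IsPointProcess X ∧ IsSimplePointProcess P X ∧
    ∃ ρ : (n : ℕ) → (Fin n → E) → ℝ≥0, HasCorrelationFunctions P X μ ρ ∧
      ∀ n, 1 ≤ n → ∀ x : Fin n → E,
        ((ρ n x : ℝ) : ℂ) = (Matrix.of fun i j => K (x i) (x j)).det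

/-- The kernel `π⁻¹ exp (-|z|²/2 - |w|²/2 + z w̄)` of the infinite Ginibre ensemble. -/
noncomputable def ginibreKernel (z w : ℂ) : ℂ :=
  (1 / (Real.pi : ℂ)) *
    Complex.exp (-(1 / 2) * (‖z‖ : ℂ) ^ 2 - (1 / 2) * (‖w‖ : ℂ) ^ 2 + z * starRingEnd ℂ w)

/-- The (infinite) Ginibre ensemble: the determinantal point process in the plane with kernel
`ginibreKernel` with respect to Lebesgue measure. -/
def IsGinibreEnsemble {Ω : Type*} [MeasurableSpace Ω] (P : Measure Ω) (X : Ω → Measure ℂ) : Prop :=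
  IsDeterminantal P X volume ginibreKernel

/-! On a disk of radius $r$ about $a$ the kernel has the form
$\sum_k\varphi_k(z)\overline{\varphi_k(w)}$, where the $\varphi_k$ are orthogonal with squared norms
$\lambda_k$ depending on $r$ but not on $a$ (`hasSum_ginibreKernel`,
`integral_ginibreEigenfunction_mul_conj`). Integrating the determinant gives $\mathbf E\binom
Nn=e_n(\lambda)$ for the number $N$ of points in the disk (`integral_det_eq_esymmSeq`), and
inclusion-exclusion recovers $\mathbf P[N\ge m]$ from these moments
(`measureReal_le_eq_alternatingTail`).

Up to a factor $e^{\pm r^2}$, both $\lambda_k$ and the tail $\sum_{i\ge k}\lambda_i$ are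
$r^{2(k+1)}/(k+1)!$. Since $\prod_{k<n}\lambda_k\le e_n(\lambda)\le\prod_{j<n}\sum_{k\ge
j}\lambda_k$, it follows that $\log e_n(\lambda)=-\frac12n^2\log n+O(n^2)$. The moments decay so
fast that for large $m$ the alternating series is governed by its first term: $\frac12e_m\le\mathbf
P[N\ge m]\le e_m$ (`alternatingTail_bounds`). -/

/-! ### Elementary symmetric functions of a summable sequence. -/

/-- The elementary symmetric polynomial of degree `n` in `l 0, …, l (M - 1)`. -/
noncomputable def esymmRange (l : ℕ → ℝ) (n M : ℕ) : ℝ :=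
  ∑ S ∈ (Finset.range M).powersetCard n, ∏ k ∈ S, l k

theorem esymmRange_zero_left (l : ℕ → ℝ) (M : ℕ) : esymmRange l 0 M = 1 := by
  simp [esymmRange]

theorem esymmRange_of_lt (l : ℕ → ℝ) {n M : ℕ} (h : M < n) : esymmRange l n M = 0 := by
  rw [esymmRange, Finset.powersetCard_eq_empty.2 (by simpa using h), Finset.sum_empty]

theorem esymmRange_succ_succ (l : ℕ → ℝ) (n M : ℕ) :
    esymmRange l (n + 1) (M + 1) = esymmRange l (n + 1) M + l M * esymmRange l n M := by
  have hM : ∀ S ∈ (Finset.range M).powersetCard n, M ∉ S := fun S hS h => by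
    simpa using (Finset.mem_powersetCard.1 hS).1 h
  rw [esymmRange, Finset.range_add_one, Finset.powersetCard_succ_insert (by simp),
    Finset.sum_union]
  · congr 1
    rw [Finset.sum_image, esymmRange, Finset.mul_sum]
    · exact Finset.sum_congr rfl fun S hS => Finset.prod_insert (hM S hS)
    · intro S hS T hT h
      rw [← Finset.erase_insert (hM S hS), ← Finset.erase_insert (hM T hT), h]
  · rw [Finset.disjoint_left]
    intro S hS hS'
    obtain ⟨T, -, rfl⟩ := Finset.mem_image.1 hS'
    simpa using (Finset.mem_powersetCard.1 hS).1 (Finset.mem_insert_self M T)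

theorem esymmRange_nonneg {l : ℕ → ℝ} (hl : ∀ k, 0 ≤ l k) (n M : ℕ) : 0 ≤ esymmRange l n M :=
  Finset.sum_nonneg fun _ _ => Finset.prod_nonneg fun k _ => hl k

theorem esymmRange_monotone {l : ℕ → ℝ} (hl : ∀ k, 0 ≤ l k) (n : ℕ) :
    Monotone (esymmRange l n) := by
  intro M M' h
  refine Finset.sum_le_sum_of_subset_of_nonneg
    (Finset.powersetCard_mono (Finset.range_mono h)) fun S _ _ => ?_
  exact Finset.prod_nonneg fun k _ => hl k

theorem esymmRange_self (l : ℕ → ℝ) (n : ℕ) :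
    esymmRange l n n = ∏ k ∈ Finset.range n, l k := by
  have := Finset.powersetCard_self (Finset.range n)
  rw [Finset.card_range] at this
  rw [esymmRange, this, Finset.sum_singleton]

/-- Subsets are sorted by their largest element $k$; the rest is an $n$-subset of the indices below
$k$. -/
theorem esymmRange_succ_eq_sum (l : ℕ → ℝ) (n M : ℕ) :
    esymmRange l (n + 1) M = ∑ k ∈ Finset.range M, l k * esymmRange l n k := by
  induction M with
  | zero => simp [esymmRange_of_lt]
  | succ M ih => rw [esymmRange_succ_succ, ih, Finset.sum_range_succ]

/-- The largest element of an $(n+1)$-subset is at least $n$, so only the tail of the sequence from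
$n$ on enters. Using the tail instead of the full sum is what makes the upper bound on $e_n$ match
the lower one. -/
theorem esymmRange_succ_le {l : ℕ → ℝ} (hl : ∀ k, 0 ≤ l k) (hs : Summable l) (n M : ℕ) :
    esymmRange l (n + 1) M ≤ (∑' k, l (k + n)) * esymmRange l n M := by
  have hs' : Summable fun k => l (k + n) := (summable_nat_add_iff n).2 hs
  rcases lt_or_ge M (n + 1) with h | h
  · rw [esymmRange_of_lt l h]
    exact mul_nonneg (tsum_nonneg fun k => hl _) (esymmRange_nonneg hl _ _)
  obtain ⟨d, rfl⟩ : ∃ d, M = n + d := ⟨M - n, by omega⟩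
  have h0 : ∑ k ∈ Finset.range n, l k * esymmRange l n k = 0 :=
    Finset.sum_eq_zero fun k hk => by rw [esymmRange_of_lt l (Finset.mem_range.1 hk), mul_zero]
  rw [esymmRange_succ_eq_sum, Finset.sum_range_add, h0, zero_add]
  calc ∑ k ∈ Finset.range d, l (n + k) * esymmRange l n (n + k)
      ≤ ∑ k ∈ Finset.range d, l (k + n) * esymmRange l n (n + d) := by
        refine Finset.sum_le_sum fun k hk => ?_
        rw [add_comm n k]
        refine mul_le_mul_of_nonneg_left (esymmRange_monotone hl n ?_) (hl _)
        have := Finset.mem_range.1 hk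
        omega
    _ ≤ _ := by
        rw [← Finset.sum_mul]
        exact mul_le_mul_of_nonneg_right (hs'.sum_le_tsum _ fun k _ => hl _)
          (esymmRange_nonneg hl _ _)

theorem esymmRange_le_prod {l : ℕ → ℝ} (hl : ∀ k, 0 ≤ l k) (hs : Summable l) (n M : ℕ) :
    esymmRange l n M ≤ ∏ j ∈ Finset.range n, ∑' k, l (k + j) := by
  induction n with
  | zero => simp [esymmRange_zero_left]
  | succ n ih =>
    rw [Finset.prod_range_succ, mul_comm]
    exact (esymmRange_succ_le hl hs n M).trans
      (mul_le_mul_of_nonneg_left ih (tsum_nonneg fun k => hl _))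

/-- The elementary symmetric function of degree `n` of a summable non-negative sequence. -/
noncomputable def esymmSeq (l : ℕ → ℝ) (n : ℕ) : ℝ := ⨆ M, esymmRange l n M

section esymmSeq

variable {l : ℕ → ℝ}

theorem bddAbove_esymmRange (hl : ∀ k, 0 ≤ l k) (hs : Summable l) (n : ℕ) :
    BddAbove (Set.range (esymmRange l n)) :=
  ⟨_, by rintro _ ⟨M, rfl⟩; exact esymmRange_le_prod hl hs n M⟩

theorem tendsto_esymmRange (hl : ∀ k, 0 ≤ l k) (hs : Summable l) (n : ℕ) :
    Tendsto (esymmRange l n) atTop (𝓝 (esymmSeq l n)) :=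
  tendsto_atTop_ciSup (esymmRange_monotone hl n) (bddAbove_esymmRange hl hs n)

theorem esymmSeq_succ_le (hl : ∀ k, 0 ≤ l k) (hs : Summable l) (n : ℕ) :
    esymmSeq l (n + 1) ≤ (∑' k, l (k + n)) * esymmSeq l n :=
  le_of_tendsto_of_tendsto' (tendsto_esymmRange hl hs (n + 1))
    ((tendsto_esymmRange hl hs n).const_mul _) fun M => esymmRange_succ_le hl hs n M

theorem esymmSeq_le_prod (hl : ∀ k, 0 ≤ l k) (hs : Summable l) (n : ℕ) :
    esymmSeq l n ≤ ∏ j ∈ Finset.range n, ∑' k, l (k + j) :=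
  ciSup_le fun M => esymmRange_le_prod hl hs n M

theorem prod_le_esymmSeq (hl : ∀ k, 0 ≤ l k) (hs : Summable l) (n : ℕ) :
    ∏ k ∈ Finset.range n, l k ≤ esymmSeq l n :=
  (esymmRange_self l n).symm.le.trans (le_ciSup (bddAbove_esymmRange hl hs n) n)

theorem esymmSeq_zero (l : ℕ → ℝ) : esymmSeq l 0 = 1 := by
  simp [esymmSeq, esymmRange_zero_left]

end esymmSeq

/-! ### Integrals of determinants with an orthogonal expansion. -/

theorem card_injective_image_eq {n M : ℕ} {S : Finset ℕ}
    (hS : S ∈ (Finset.range M).powersetCard n) :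
    (((Fintype.piFinset fun _ : Fin n => Finset.range M).filter
      fun f => Function.Injective f ∧ Finset.univ.image f = S)).card = n.factorial := by
  obtain ⟨hSM, hc⟩ := Finset.mem_powersetCard.1 hS
  have hP : (Finset.univ : Finset (Equiv.Perm (Fin n))).card = n.factorial := by
    rw [Finset.card_univ, Fintype.card_perm, Fintype.card_fin]
  rw [← hP]
  symm
  -- The injections onto $S$ are the permutations followed by the increasing enumeration of $S$.
  refine Finset.card_bij (fun σ _ i => S.orderEmbOfFin hc (σ i)) ?_ ?_ ?_
  · intro σ _
    simp only [Finset.mem_filter, Fintype.mem_piFinset]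
    refine ⟨fun i => hSM (Finset.orderEmbOfFin_mem S hc _),
      (S.orderEmbOfFin hc).injective.comp σ.injective, ?_⟩
    ext k
    have hk : k ∈ S ↔ k ∈ Set.range (S.orderEmbOfFin hc) := by
      rw [Finset.range_orderEmbOfFin, Finset.mem_coe]
    rw [hk, Finset.mem_image]
    constructor
    · rintro ⟨i, -, rfl⟩
      exact ⟨σ i, rfl⟩
    · rintro ⟨i, rfl⟩
      exact ⟨σ.symm i, Finset.mem_univ _, by simp⟩
  · intro σ _ τ _ h
    ext i
    exact congrArg Fin.val ((S.orderEmbOfFin hc).injective (congrFun h i))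
  · intro f hf
    obtain ⟨-, hinj, him⟩ := Finset.mem_filter.1 hf
    have hex : ∀ i, ∃ j, S.orderEmbOfFin hc j = f i := fun i => by
      have : f i ∈ S := him ▸ Finset.mem_image_of_mem f (Finset.mem_univ i)
      rwa [← Finset.mem_coe, ← Finset.range_orderEmbOfFin S hc] at this
    choose g hg using hex
    have hgi : Function.Injective g := fun i j hij => hinj (by rw [← hg, ← hg, hij])
    exact ⟨Equiv.ofBijective g (Finite.injective_iff_bijective.1 hgi), Finset.mem_univ _,
      funext fun i => hg i⟩

theorem sum_injective_prod_eq (l : ℕ → ℝ) (n M : ℕ) :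
    ∑ f ∈ (Fintype.piFinset fun _ : Fin n => Finset.range M).filter Function.Injective,
      ∏ i, l (f i) = n.factorial * esymmRange l n M := by
  rw [esymmRange, Finset.mul_sum, ← Finset.sum_fiberwise_of_maps_to
    (t := (Finset.range M).powersetCard n) (g := fun f => Finset.univ.image f)]
  · refine Finset.sum_congr rfl fun S hS => ?_
    rw [Finset.filter_filter, ← card_injective_image_eq hS, ← nsmul_eq_mul]
    refine Finset.sum_eq_card_nsmul fun f hf => ?_
    obtain ⟨-, hinj, him⟩ := Finset.mem_filter.1 hf
    rw [← him, Finset.prod_image hinj.injOn]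
  · intro f hf
    obtain ⟨hf, hinj⟩ := Finset.mem_filter.1 hf
    rw [Finset.mem_powersetCard, Finset.card_image_of_injective _ hinj]
    refine ⟨fun k hk => ?_, by simp⟩
    obtain ⟨i, -, rfl⟩ := Finset.mem_image.1 hk
    exact Fintype.mem_piFinset.1 hf i

theorem det_ite_eq {n : ℕ} (f : Fin n → ℕ) :
    (Matrix.of fun i j => if f i = f j then (1 : ℂ) else 0).det =
      if Function.Injective f then 1 else 0 := by
  split_ifs with h
  · have : (Matrix.of fun i j => if f i = f j then (1 : ℂ) else 0) = 1 := by
      ext i j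
      simp [Matrix.one_apply, h.eq_iff]
    rw [this, Matrix.det_one]
  · obtain ⟨i, j, hij, hne⟩ : ∃ i j, f i = f j ∧ i ≠ j := by
      simpa [Function.Injective] using h
    refine Matrix.det_zero_of_row_eq hne (funext fun k => ?_)
    simp [hij]

section integral_det

variable {α : Type*} [MeasurableSpace α] {μ : Measure α} [SigmaFinite μ]
  {φ : ℕ → α → ℂ} {l : ℕ → ℝ}

theorem det_sum_mul_conj {α : Type*} (φ : ℕ → α → ℂ) (n M : ℕ) (x : Fin n → α) :
    (Matrix.of fun i j => ∑ k ∈ Finset.range M, φ k (x i) * starRingEnd ℂ (φ k (x j))).det =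
      ∑ f ∈ Fintype.piFinset fun _ : Fin n => Finset.range M, ∑ σ : Equiv.Perm (Fin n),
        (Equiv.Perm.sign σ : ℂ) *
          ∏ i, φ (f (σ.symm i)) (x i) * starRingEnd ℂ (φ (f i) (x i)) := by
  rw [Matrix.det_apply', Finset.sum_comm]
  refine Finset.sum_congr rfl fun σ _ => ?_
  simp only [Matrix.of_apply]
  rw [Finset.prod_univ_sum, Finset.mul_sum]
  refine Finset.sum_congr rfl fun f _ => ?_
  -- Reindexing the unconjugated factors by $\sigma$ collects everything that depends on one
  -- variable $x_i$, so that the integral factorises.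
  rw [Finset.prod_mul_distrib, Finset.prod_mul_distrib,
    ← Equiv.prod_comp σ fun i => φ (f (σ.symm i)) (x i)]
  simp

/-- Orthogonality kills every term except those with $f\circ\sigma=f$. The signs of these $\sigma$
sum to the determinant of the matrix $[f(i)=f(j)]$, which singles out the injective $f$. -/
theorem integral_det_sum_mul_conj
    (hint : ∀ j k, Integrable (fun z => φ j z * starRingEnd ℂ (φ k z)) μ)
    (horth : ∀ j k, ∫ z, φ j z * starRingEnd ℂ (φ k z) ∂μ = if j = k then (l k : ℂ) else 0)
    (n M : ℕ) :
    ∫ x : Fin n → α, (Matrix.of fun i j =>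
        ∑ k ∈ Finset.range M, φ k (x i) * starRingEnd ℂ (φ k (x j))).det
          ∂(Measure.pi fun _ => μ) = (n.factorial * esymmRange l n M : ℝ) := by
  simp_rw [det_sum_mul_conj]
  have hprod : ∀ (f : Fin n → ℕ) (σ : Equiv.Perm (Fin n)),
      Integrable (fun x : Fin n → α => (Equiv.Perm.sign σ : ℂ) *
        ∏ i, φ (f (σ.symm i)) (x i) * starRingEnd ℂ (φ (f i) (x i)))
        (Measure.pi fun _ => μ) := fun f σ =>
    (Integrable.fintype_prod (f := fun i z => φ (f (σ.symm i)) z * starRingEnd ℂ (φ (f i) z))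
      fun i => hint _ _).const_mul _
  rw [integral_finsetSum _ fun f _ => integrable_finsetSum _ fun σ _ => hprod f σ,
    ← sum_injective_prod_eq, Finset.sum_filter, Complex.ofReal_sum]
  refine Finset.sum_congr rfl fun f _ => ?_
  rw [integral_finsetSum _ fun σ _ => hprod f σ]
  have hσ : ∀ σ : Equiv.Perm (Fin n), ∫ x : Fin n → α, (Equiv.Perm.sign σ : ℂ) *
        ∏ i, φ (f (σ.symm i)) (x i) * starRingEnd ℂ (φ (f i) (x i)) ∂(Measure.pi fun _ => μ) =
      ((Equiv.Perm.sign σ : ℂ) * ∏ i, if f (σ i) = f i then (1 : ℂ) else 0) *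
        ∏ i, (l (f i) : ℂ) := by
    intro σ
    rw [integral_const_mul, integral_fintype_prod_eq_prod (𝕜 := ℂ)
      (f := fun i z => φ (f (σ.symm i)) z * starRingEnd ℂ (φ (f i) z)), mul_assoc]
    congr 1
    simp_rw [horth]
    rw [← Equiv.prod_comp σ fun i => if f (σ.symm i) = f i then (l (f i) : ℂ) else 0,
      ← Equiv.prod_comp σ fun i => (l (f i) : ℂ), ← Finset.prod_mul_distrib]
    refine Finset.prod_congr rfl fun i _ => ?_
    simp [eq_comm]
  simp_rw [hσ]
  rw [← Finset.sum_mul]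
  have := det_ite_eq f
  rw [Matrix.det_apply'] at this
  simp only [Matrix.of_apply] at this
  rw [this]
  split_ifs <;> simp

theorem norm_det_le_of_norm_le {n : ℕ} (A : Matrix (Fin n) (Fin n) ℂ) {C : ℝ}
    (h : ∀ i j, ‖A i j‖ ≤ C) : ‖A.det‖ ≤ n.factorial * C ^ n := by
  rw [Matrix.det_apply']
  refine (norm_sum_le_of_le _ (n := fun _ => C ^ n) fun σ _ => ?_).trans ?_
  · have hs : ‖((Equiv.Perm.sign σ : ℤ) : ℂ)‖ = 1 := by
      rcases Int.units_eq_one_or (Equiv.Perm.sign σ) with h | h <;> simp [h]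
    rw [norm_mul, hs, one_mul, norm_prod]
    calc ∏ i, ‖A (σ i) i‖ ≤ ∏ _i : Fin n, C :=
          Finset.prod_le_prod (fun _ _ => norm_nonneg _) fun i _ => h _ _
      _ = C ^ n := by simp
  · simp [Fintype.card_perm]

/-- The `n`-point integral of a determinantal kernel with an orthogonal expansion. -/
theorem integral_det_eq_esymmSeq [IsFiniteMeasure μ] {K : α → α → ℂ} {C : ℝ}
    (hl : ∀ k, 0 ≤ l k) (hs : Summable l) (hφ : ∀ k, Measurable (φ k))
    (hint : ∀ j k, Integrable (fun z => φ j z * starRingEnd ℂ (φ k z)) μ)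
    (horth : ∀ j k, ∫ z, φ j z * starRingEnd ℂ (φ k z) ∂μ = if j = k then (l k : ℂ) else 0)
    (hK : ∀ z w, HasSum (fun k => φ k z * starRingEnd ℂ (φ k w)) (K z w))
    (hC : ∀ M z w, ‖∑ k ∈ Finset.range M, φ k z * starRingEnd ℂ (φ k w)‖ ≤ C) (n : ℕ) :
    ∫ x : Fin n → α, (Matrix.of fun i j => K (x i) (x j)).det ∂(Measure.pi fun _ => μ) =
      (n.factorial * esymmSeq l n : ℝ) := by
  have h1 : Tendsto (fun M => ∫ x : Fin n → α, (Matrix.of fun i j =>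
        ∑ k ∈ Finset.range M, φ k (x i) * starRingEnd ℂ (φ k (x j))).det
          ∂(Measure.pi fun _ => μ)) atTop
      (𝓝 (∫ x : Fin n → α, (Matrix.of fun i j => K (x i) (x j)).det
        ∂(Measure.pi fun _ => μ))) := by
    -- The Leibniz formula turns the uniform bound $C$ on the partial sums into a constant
    -- dominating function, integrable since $\mu$ is finite.
    refine tendsto_integral_of_dominated_convergence (fun _ => n.factorial * C ^ n) ?_
      (integrable_const _) ?_ ?_
    · intro M
      refine Measurable.aestronglyMeasurable ?_
      simp_rw [Matrix.det_apply', Matrix.of_apply]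
      have := fun k => Complex.continuous_conj.measurable.comp (hφ k)
      fun_prop
    · exact fun M => ae_of_all _ fun x => norm_det_le_of_norm_le _ fun i j => hC M _ _
    · refine ae_of_all _ fun x => ?_
      have hA : Tendsto (fun M => (Matrix.of fun i j : Fin n =>
          ∑ k ∈ Finset.range M, φ k (x i) * starRingEnd ℂ (φ k (x j)))) atTop
          (𝓝 (Matrix.of fun i j => K (x i) (x j))) :=
        tendsto_pi_nhds.2 fun i => tendsto_pi_nhds.2 fun j => (hK _ _).tendsto_sum_nat
      exact ((Continuous.matrix_det continuous_id).tendsto _).comp hA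
  simp_rw [integral_det_sum_mul_conj hint horth] at h1
  refine tendsto_nhds_unique h1 ?_
  exact (Complex.continuous_ofReal.tendsto _).comp
    ((tendsto_esymmRange hl hs n).const_mul _)

end integral_det

/-! ### Eigenvalues of the Ginibre kernel on a disk. -/

theorem integral_ball_norm_pow {r : ℝ} (hr : 0 < r) (k : ℕ) :
    ∫ z : ℂ in Metric.ball 0 r, ‖z‖ ^ (2 * k) = Real.pi * (r ^ 2) ^ (k + 1) / (k + 1) := by
  have h := integral_fun_norm_addHaar (volume : Measure ℂ)
    (fun t : ℝ => (Set.Iio r).indicator (fun t => t ^ (2 * k)) t)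
  have h1 : ∫ z : ℂ in Metric.ball 0 r, ‖z‖ ^ (2 * k) =
      ∫ z : ℂ, (Set.Iio r).indicator (fun t => t ^ (2 * k)) ‖z‖ := by
    rw [← integral_indicator measurableSet_ball]
    refine integral_congr_ae (ae_of_all _ fun z => ?_)
    simp [Set.indicator]
  have h2 : ∀ y : ℝ, y ^ (Module.finrank ℝ ℂ - 1) •
      (Set.Iio r).indicator (fun t => t ^ (2 * k)) y =
        (Set.Iio r).indicator (fun t => t ^ (2 * k + 1)) y := fun y => by
    by_cases hy : y ∈ Set.Iio r <;> simp [hy, Complex.finrank_real_complex, pow_succ']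
  rw [h1, h]
  simp_rw [h2]
  rw [setIntegral_indicator measurableSet_Iio, Set.Ioi_inter_Iio,
    ← integral_Ioc_eq_integral_Ioo, ← intervalIntegral.integral_of_le hr.le, integral_pow,
    Complex.finrank_real_complex, measureReal_def, Complex.volume_ball]
  simp
  field_simp
  ring

/-- Rotation invariance of the disk gives $\int g=s\int g$. -/
theorem setIntegral_ball_rotation {r : ℝ} {g : ℂ → ℂ} {c : ℂ} (hc : ‖c‖ = 1) {s : ℂ}
    (hg : ∀ z, g (c * z) = s * g z) (hs : s ≠ 1) : ∫ z in Metric.ball 0 r, g z = 0 := by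
  let u : Circle := ⟨c, mem_sphere_zero_iff_norm.2 hc⟩
  have hmp := (rotation u).measurePreserving
  have h1 := hmp.setIntegral_preimage_emb
    (rotation u).toHomeomorph.measurableEmbedding g (Metric.ball 0 r)
  have h2 : rotation u ⁻¹' Metric.ball 0 r = Metric.ball 0 r := by
    ext z
    simp only [Set.mem_preimage, mem_ball_zero_iff, LinearIsometryEquiv.norm_map]
  have h3 : ∀ z, g (rotation u z) = s * g z := fun z => hg z
  rw [h2] at h1
  simp_rw [h3] at h1
  rw [integral_const_mul] at h1
  have h4 : (s - 1) * ∫ z in Metric.ball 0 r, g z = 0 := by rw [sub_mul, h1, one_mul, sub_self]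
  exact (mul_eq_zero.1 h4).resolve_left (sub_ne_zero.2 hs)

/-- The eigenvalues of the Ginibre kernel restricted to a disk of radius `r`. -/
noncomputable def ginibreEigenvalue (r : ℝ) (k : ℕ) : ℝ :=
  (∫ z : ℂ in Metric.ball 0 r, ‖z‖ ^ (2 * k) * Real.exp (-‖z‖ ^ 2)) / (Real.pi * k.factorial)

theorem integrableOn_ball_of_continuous {E : Type*} [NormedAddCommGroup E] {f : ℂ → E}
    (hf : Continuous f) (a : ℂ) (r : ℝ) :
    IntegrableOn f (Metric.ball a r) :=
  (hf.continuousOn.integrableOn_compact (isCompact_closedBall a r)).mono_set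
    Metric.ball_subset_closedBall

theorem ginibreEigenvalue_le {r : ℝ} (hr : 0 < r) (k : ℕ) :
    ginibreEigenvalue r k ≤ (r ^ 2) ^ (k + 1) / (k + 1).factorial := by
  have h : ∫ z : ℂ in Metric.ball 0 r, ‖z‖ ^ (2 * k) * Real.exp (-‖z‖ ^ 2) ≤
      Real.pi * (r ^ 2) ^ (k + 1) / (k + 1) := by
    rw [← integral_ball_norm_pow hr k]
    refine setIntegral_mono (integrableOn_ball_of_continuous (by fun_prop) _ _)
      (integrableOn_ball_of_continuous (by fun_prop) _ _) fun z => ?_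
    exact mul_le_of_le_one_right (by positivity) (Real.exp_le_one_iff.2 (by simp))
  calc ginibreEigenvalue r k ≤ _ := div_le_div_of_nonneg_right h (by positivity)
    _ = _ := by
      rw [Nat.factorial_succ]
      push_cast
      field_simp

theorem le_ginibreEigenvalue {r : ℝ} (hr : 0 < r) (k : ℕ) :
    Real.exp (-r ^ 2) * ((r ^ 2) ^ (k + 1) / (k + 1).factorial) ≤ ginibreEigenvalue r k := by
  have h : Real.exp (-r ^ 2) * (Real.pi * (r ^ 2) ^ (k + 1) / (k + 1)) ≤
      ∫ z : ℂ in Metric.ball 0 r, ‖z‖ ^ (2 * k) * Real.exp (-‖z‖ ^ 2) := by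
    rw [← integral_ball_norm_pow hr k, ← integral_const_mul]
    refine setIntegral_mono_on (integrableOn_ball_of_continuous (by fun_prop) _ _)
      (integrableOn_ball_of_continuous (by fun_prop) _ _) measurableSet_ball fun z hz => ?_
    rw [mul_comm]
    have hz : ‖z‖ < r := by simpa using hz
    gcongr
  calc _ = Real.exp (-r ^ 2) * (Real.pi * (r ^ 2) ^ (k + 1) / (k + 1)) /
        (Real.pi * k.factorial) := by
        rw [Nat.factorial_succ]
        push_cast
        field_simp
    _ ≤ _ := div_le_div_of_nonneg_right h (by positivity)

theorem ginibreEigenvalue_pos {r : ℝ} (hr : 0 < r) (k : ℕ) : 0 < ginibreEigenvalue r k :=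
  lt_of_lt_of_le (by positivity) (le_ginibreEigenvalue hr k)

theorem summable_ginibreEigenvalue {r : ℝ} (hr : 0 < r) : Summable (ginibreEigenvalue r) :=
  Summable.of_nonneg_of_le (fun k => (ginibreEigenvalue_pos hr k).le) (ginibreEigenvalue_le hr)
    ((summable_nat_add_iff 1).2 (Real.summable_pow_div_factorial (r ^ 2)))

theorem tsum_ginibreEigenvalue_le {r : ℝ} (hr : 0 < r) (n : ℕ) :
    ∑' k, ginibreEigenvalue r (k + n) ≤
      Real.exp (r ^ 2) * ((r ^ 2) ^ (n + 1) / (n + 1).factorial) := by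
  have h : HasSum (fun k : ℕ => (r ^ 2) ^ k / k.factorial * ((r ^ 2) ^ (n + 1) / (n + 1).factorial))
      (Real.exp (r ^ 2) * ((r ^ 2) ^ (n + 1) / (n + 1).factorial)) := by
    rw [Real.exp_eq_exp_ℝ]
    exact (NormedSpace.expSeries_div_hasSum_exp (r ^ 2)).mul_right _
  rw [← h.tsum_eq]
  refine Summable.tsum_le_tsum (fun k => (ginibreEigenvalue_le hr _).trans ?_)
    ((summable_nat_add_iff n).2 (summable_ginibreEigenvalue hr)) h.summable
  -- Since $k!\,(n+1)!\le(k+n+1)!$, the tail is dominated by an exponential series.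
  rw [div_mul_div_comm, ← pow_add, add_assoc]
  refine div_le_div_of_nonneg_left (by positivity) (by positivity) ?_
  exact_mod_cast Nat.le_of_dvd (Nat.factorial_pos _) (Nat.factorial_mul_factorial_dvd_factorial_add k (n + 1))

/-! ### Eigenfunctions and expansion of the Ginibre kernel. -/

/-- The eigenfunctions of the Ginibre kernel on disks centred at `a`. -/
noncomputable def ginibreEigenfunction (a : ℂ) (k : ℕ) (z : ℂ) : ℂ :=
  Complex.exp (((z * starRingEnd ℂ a).im : ℂ) * Complex.I - (1 / 2) * (‖z - a‖ : ℂ) ^ 2) *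
    ((z - a) ^ k / (Real.sqrt (Real.pi * k.factorial) : ℂ))

theorem continuous_ginibreEigenfunction (a : ℂ) (k : ℕ) :
    Continuous (ginibreEigenfunction a k) := by
  unfold ginibreEigenfunction
  have := Complex.continuous_conj
  fun_prop

theorem ginibreEigenfunction_mul_conj (a : ℂ) (j k : ℕ) (z w : ℂ) :
    ginibreEigenfunction a j z * starRingEnd ℂ (ginibreEigenfunction a k w) =
      Complex.exp ((((z - w) * starRingEnd ℂ a).im : ℂ) * Complex.I
        - (1 / 2) * (‖z - a‖ : ℂ) ^ 2 - (1 / 2) * (‖w - a‖ : ℂ) ^ 2) *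
      ((z - a) ^ j * starRingEnd ℂ (w - a) ^ k /
        ((Real.sqrt (Real.pi * j.factorial) : ℂ) * (Real.sqrt (Real.pi * k.factorial) : ℂ))) := by
  rw [ginibreEigenfunction, ginibreEigenfunction, map_mul, ← Complex.exp_conj, map_div₀, map_pow,
    Complex.conj_ofReal, mul_mul_mul_comm, ← Complex.exp_add, div_mul_div_comm]
  congr 2
  simp only [map_sub, map_mul, Complex.conj_ofReal, Complex.conj_I, map_pow, map_div₀, map_one,
    map_ofNat, sub_mul, Complex.sub_im, Complex.ofReal_sub]
  ring

theorem integral_ginibreEigenfunction_mul_conj (a : ℂ) {r : ℝ} (j k : ℕ) :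
    ∫ z in Metric.ball a r, ginibreEigenfunction a j z *
      starRingEnd ℂ (ginibreEigenfunction a k z) =
        if j = k then (ginibreEigenvalue r k : ℂ) else 0 := by
  set g : ℂ → ℂ := fun z => Complex.exp (-(‖z‖ : ℂ) ^ 2) * (z ^ j * starRingEnd ℂ z ^ k /
        ((Real.sqrt (Real.pi * j.factorial) : ℂ) * (Real.sqrt (Real.pi * k.factorial) : ℂ))) with hg
  have h1 : ∀ z, ginibreEigenfunction a j z * starRingEnd ℂ (ginibreEigenfunction a k z) =
      g (z - a) := fun z => by
    rw [ginibreEigenfunction_mul_conj, hg]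
    simp only [sub_self, zero_mul, Complex.zero_im, Complex.ofReal_zero]
    congr 2
    ring
  have h2 : ∫ z in Metric.ball a r, g (z - a) = ∫ z in Metric.ball 0 r, g z := by
    have := (measurePreserving_sub_right (volume : Measure ℂ) a).setIntegral_preimage_emb
      (MeasurableEquiv.subRight a).measurableEmbedding g (Metric.ball 0 r)
    rw [← this]
    congr 2
    ext z
    simp [dist_eq_norm]
  simp_rw [h1]
  rw [h2]
  split_ifs with hjk
  · subst hjk
    have h3 : ∀ z, g z = ((‖z‖ ^ (2 * j) * Real.exp (-‖z‖ ^ 2) / (Real.pi * j.factorial) : ℝ) : ℂ) := by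
      intro z
      have hsq : (Real.sqrt (Real.pi * j.factorial) : ℂ) * (Real.sqrt (Real.pi * j.factorial) : ℂ) =
          ((Real.pi * j.factorial : ℝ) : ℂ) := by
        rw [← Complex.ofReal_mul, Real.mul_self_sqrt (by positivity)]
      simp only [hg]
      rw [hsq, ← mul_pow, Complex.mul_conj, Complex.normSq_eq_norm_sq]
      push_cast
      ring
    simp_rw [h3]
    rw [integral_complex_ofReal, integral_div, ginibreEigenvalue]
  -- Rotation by one radian serves all $j\ne k$ at once: $e^{i(j-k)}\ne1$ because $\pi$ is
  -- irrational.
  · have hc : ‖Complex.exp Complex.I‖ = 1 := by simpa using Complex.norm_exp_ofReal_mul_I 1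
    refine setIntegral_ball_rotation hc
      (s := Complex.exp Complex.I ^ j * starRingEnd ℂ (Complex.exp Complex.I) ^ k) ?_ ?_
    · intro z
      simp only [hg, norm_mul, hc, one_mul, map_mul, mul_pow]
      ring
    · rw [← Complex.exp_conj, Complex.conj_I, ← Complex.exp_nat_mul, ← Complex.exp_nat_mul,
        ← Complex.exp_add, Ne, Complex.exp_eq_one_iff]
      rintro ⟨n, hn⟩
      have h5 : ((j : ℂ) - k) * Complex.I = (n * (2 * Real.pi)) * Complex.I := by
        linear_combination hn
      have h6 := mul_right_cancel₀ Complex.I_ne_zero h5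
      have h7 : ((j : ℤ) - k : ℝ) = n * (2 * Real.pi) := by exact_mod_cast h6
      rcases eq_or_ne n 0 with rfl | hn0
      · apply hjk
        have : ((j : ℤ) : ℝ) = k := by simpa [sub_eq_zero] using h7
        exact_mod_cast this
      · refine irrational_pi ⟨((j : ℤ) - k : ℤ) / (n * 2 : ℤ), ?_⟩
        have : (n : ℝ) ≠ 0 := by exact_mod_cast hn0
        push_cast
        rw [div_eq_iff (by positivity)]
        push_cast at h7
        rw [h7]
        ring

/-- Translating both arguments by $a$ changes the kernel only by the phase
$e^{i\,\mathrm{Im}((z-w)\bar a)}$, which the phase of the eigenfunctions absorbs. What remains is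
the exponential series of $(z-a)\overline{(w-a)}$. -/
theorem hasSum_ginibreKernel (a z w : ℂ) :
    HasSum (fun k => ginibreEigenfunction a k z * starRingEnd ℂ (ginibreEigenfunction a k w))
      (ginibreKernel z w) := by
  have h := ((NormedSpace.expSeries_div_hasSum_exp ((z - a) * starRingEnd ℂ (w - a))).mul_left
    (Complex.exp ((((z - w) * starRingEnd ℂ a).im : ℂ) * Complex.I
        - (1 / 2) * (‖z - a‖ : ℂ) ^ 2 - (1 / 2) * (‖w - a‖ : ℂ) ^ 2))).div_const (Real.pi : ℂ)
  rw [← Complex.exp_eq_exp_ℂ, ← Complex.exp_add] at h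
  have hE : (((z - w) * starRingEnd ℂ a).im : ℂ) * Complex.I - (1 / 2) * (‖z - a‖ : ℂ) ^ 2
      - (1 / 2) * (‖w - a‖ : ℂ) ^ 2 + (z - a) * starRingEnd ℂ (w - a) =
      -(1 / 2) * (‖z‖ : ℂ) ^ 2 - (1 / 2) * (‖w‖ : ℂ) ^ 2 + z * starRingEnd ℂ w := by
    have him : ∀ u : ℂ, (u.im : ℂ) * Complex.I = (u - starRingEnd ℂ u) / 2 := fun u => by
      rw [Complex.sub_conj]
      push_cast
      ring
    simp only [him, ← Complex.mul_conj', map_sub, map_mul, Complex.conj_conj]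
    ring
  have hK : ginibreKernel z w = Complex.exp ((((z - w) * starRingEnd ℂ a).im : ℂ) * Complex.I
      - (1 / 2) * (‖z - a‖ : ℂ) ^ 2 - (1 / 2) * (‖w - a‖ : ℂ) ^ 2 +
        (z - a) * starRingEnd ℂ (w - a)) / (Real.pi : ℂ) := by
    rw [hE, ginibreKernel]
    ring
  rw [hK]
  refine (congrArg (HasSum · _) (funext fun k => ?_)).mpr h
  rw [ginibreEigenfunction_mul_conj, ← Complex.ofReal_mul, Real.mul_self_sqrt (by positivity)]
  push_cast
  rw [mul_pow]
  field_simp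

/-- Termwise absolute values sum to at most $\frac1\pi e^{-(|z-a|-|w-a|)^2/2}$. This is the uniform
bound for dominated convergence. -/
theorem norm_sum_ginibreEigenfunction_le (a : ℂ) (M : ℕ) (z w : ℂ) :
    ‖∑ k ∈ Finset.range M, ginibreEigenfunction a k z *
      starRingEnd ℂ (ginibreEigenfunction a k w)‖ ≤ 1 / Real.pi := by
  have hn : ∀ k, ‖ginibreEigenfunction a k z * starRingEnd ℂ (ginibreEigenfunction a k w)‖ =
      Real.exp (-(1 / 2) * ‖z - a‖ ^ 2 - (1 / 2) * ‖w - a‖ ^ 2) / Real.pi *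
        ((‖z - a‖ * ‖w - a‖) ^ k / k.factorial) := fun k => by
    rw [ginibreEigenfunction_mul_conj, ← Complex.ofReal_mul, Real.mul_self_sqrt (by positivity),
      norm_mul, norm_div, norm_mul, norm_pow, norm_pow, RCLike.norm_conj, Complex.norm_exp,
      Complex.norm_of_nonneg (by positivity), mul_pow]
    have : ((((z - w) * starRingEnd ℂ a).im : ℂ) * Complex.I - (1 / 2) * (‖z - a‖ : ℂ) ^ 2
        - (1 / 2) * (‖w - a‖ : ℂ) ^ 2).re = -(1 / 2) * ‖z - a‖ ^ 2 - (1 / 2) * ‖w - a‖ ^ 2 := by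
      have hre : ∀ x : ℝ, ((1 / 2 : ℂ) * (x : ℂ) ^ 2).re = 1 / 2 * x ^ 2 := fun x => by
        rw [show (1 / 2 : ℂ) * (x : ℂ) ^ 2 = ((1 / 2 * x ^ 2 : ℝ) : ℂ) by push_cast; ring,
          Complex.ofReal_re]
      rw [Complex.sub_re, Complex.sub_re, hre, hre, Complex.re_ofReal_mul, Complex.I_re]
      ring
    rw [this]
    field_simp
  refine (norm_sum_le _ _).trans ?_
  simp_rw [hn]
  rw [← Finset.mul_sum]
  have hs : ∑ k ∈ Finset.range M, (‖z - a‖ * ‖w - a‖) ^ k / k.factorial ≤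
      Real.exp (‖z - a‖ * ‖w - a‖) := Real.sum_le_exp_of_nonneg (by positivity) M
  calc _ ≤ Real.exp (-(1 / 2) * ‖z - a‖ ^ 2 - (1 / 2) * ‖w - a‖ ^ 2) / Real.pi *
        Real.exp (‖z - a‖ * ‖w - a‖) := by gcongr
    _ = Real.exp (-(1 / 2) * ‖z - a‖ ^ 2 - (1 / 2) * ‖w - a‖ ^ 2 + ‖z - a‖ * ‖w - a‖) / Real.pi := by
        rw [Real.exp_add]
        ring
    _ ≤ 1 / Real.pi := by
        gcongr
        rw [Real.exp_le_one_iff]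
        nlinarith [sq_nonneg (‖z - a‖ - ‖w - a‖)]

theorem integral_det_ginibreKernel (a : ℂ) {r : ℝ} (hr : 0 < r) (n : ℕ) :
    ∫ x : Fin n → ℂ, (Matrix.of fun i j => ginibreKernel (x i) (x j)).det
      ∂(Measure.pi fun _ => volume.restrict (Metric.ball a r)) =
      (n.factorial * esymmSeq (ginibreEigenvalue r) n : ℝ) := by
  have : IsFiniteMeasure ((volume : Measure ℂ).restrict (Metric.ball a r)) :=
    isFiniteMeasure_restrict.2 measure_ball_lt_top.ne
  exact integral_det_eq_esymmSeq (fun k => (ginibreEigenvalue_pos hr k).le)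
    (summable_ginibreEigenvalue hr) (fun k => (continuous_ginibreEigenfunction a k).measurable)
    (fun j k => integrableOn_ball_of_continuous ((continuous_ginibreEigenfunction a j).mul
      (Complex.continuous_conj.comp (continuous_ginibreEigenfunction a k))) a r)
    (integral_ginibreEigenfunction_mul_conj a) (hasSum_ginibreKernel a) (norm_sum_ginibreEigenfunction_le a) n

/-! ### Tail probabilities from binomial moments. -/

theorem hasSum_alternating_choose_mul_choose (N p : ℕ) :
    HasSum (fun i : ℕ => (-1 : ℝ) ^ i * ((p + i).choose p * N.choose (p + i)))
      (if N = p then 1 else 0) := by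
  -- This reduces the claim to the alternating sum of a row of Pascal's triangle. For $N<p$ the
  -- subtraction truncates, but then $\binom Np=0$.
  have h : ∀ i, ((p + i).choose p * N.choose (p + i) : ℝ) = N.choose p * (N - p).choose i := by
    intro i
    rcases le_or_gt (p + i) N with hi | hi
    · have := Nat.choose_mul (n := N) (k := p + i) (s := p) (by omega)
      rw [Nat.add_sub_cancel_left] at this
      rw [mul_comm]
      exact_mod_cast this
    · rw [Nat.choose_eq_zero_of_lt hi]
      rcases le_or_gt p N with hp | hp
      · rw [Nat.choose_eq_zero_of_lt (show N - p < i by omega)]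
        simp
      · rw [Nat.choose_eq_zero_of_lt hp]
        simp
  simp_rw [h]
  have hval : (if N = p then (1 : ℝ) else 0) = ∑ i ∈ Finset.range (N - p + 1),
      (-1 : ℝ) ^ i * (N.choose p * (N - p).choose i) := by
    have halt : ∑ i ∈ Finset.range (N - p + 1), (-1 : ℝ) ^ i * ((N - p).choose i) =
        if N - p = 0 then 1 else 0 := by exact_mod_cast Int.alternating_sum_range_choose (n := N - p)
    simp_rw [mul_left_comm _ (N.choose p : ℝ)]
    rw [← Finset.mul_sum, halt]
    rcases lt_trichotomy N p with hp | rfl | hp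
    · simp [hp.ne, Nat.choose_eq_zero_of_lt hp]
    · simp
    · simp [hp.ne', Nat.sub_ne_zero_of_lt hp]
  rw [hval]
  refine hasSum_sum_of_ne_finset_zero fun i hi => ?_
  rw [Nat.choose_eq_zero_of_lt (show N - p < i by simpa using hi)]
  simp

/-- Inclusion-exclusion for the indicator of $N\ge p+1$, by Pascal's rule: passing from $N$ to $N+1$
adds the indicator of $N=p$. -/
theorem hasSum_alternating_choose_mul_choose_succ (N p : ℕ) :
    HasSum (fun i : ℕ => (-1 : ℝ) ^ i * ((p + i).choose p * N.choose (p + i + 1)))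
      (if p + 1 ≤ N then 1 else 0) := by
  induction N with
  | zero => simp
  | succ N ih =>
    have h := (hasSum_alternating_choose_mul_choose N p).add ih
    have hval : (if N = p then (1 : ℝ) else 0) + (if p + 1 ≤ N then 1 else 0) =
        if p + 1 ≤ N + 1 then 1 else 0 := by
      rcases lt_trichotomy N p with hp | rfl | hp
      · rw [if_neg hp.ne, if_neg (by omega), if_neg (by omega), add_zero]
      · simp
      · rw [if_neg hp.ne', if_pos (by omega), if_pos (by omega), zero_add]
    rw [hval] at h
    refine (congrArg (HasSum · _) (funext fun i => ?_)).mpr h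
    rw [Nat.choose_succ_succ N (p + i)]
    push_cast
    ring

/-- The probability `ℙ(N ≥ p + 1)` in terms of the binomial moments `e n = 𝔼 (N choose n)`. -/
noncomputable def alternatingTail (e : ℕ → ℝ) (p : ℕ) : ℝ :=
  ∑' i : ℕ, (-1 : ℝ) ^ i * ((p + i).choose p * e (p + i + 1))

theorem summable_choose_mul {e : ℕ → ℝ} (he : ∀ n, 0 ≤ e n) (hs : Summable fun n => 2 ^ n * e n)
    (p : ℕ) : Summable fun i => ((p + i).choose p : ℝ) * e (p + i + 1) := by
  refine Summable.of_nonneg_of_le (fun i => mul_nonneg (Nat.cast_nonneg _) (he _)) (fun i => ?_)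
    ((summable_nat_add_iff (p + 1)).2 hs)
  rw [show i + (p + 1) = p + i + 1 by ring]
  refine mul_le_mul_of_nonneg_right ?_ (he _)
  calc ((p + i).choose p : ℝ) ≤ 2 ^ (p + i) := by exact_mod_cast Nat.choose_le_two_pow _ _
    _ ≤ 2 ^ (p + i + 1) := pow_le_pow_right₀ one_le_two (Nat.le_succ _)

section tail

variable {Ω : Type*} [MeasurableSpace Ω] {P : Measure Ω} {N : Ω → ℕ} {e : ℕ → ℝ}

/-- This is the expectation of the pointwise inclusion-exclusion identity; summability of $2^ne_n$
justifies exchanging sum and expectation. -/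
theorem measureReal_le_eq_alternatingTail (hN : Measurable N) (he : ∀ n, 0 ≤ e n)
    (hs : Summable fun n => 2 ^ n * e n)
    (hint : ∀ n, Integrable (fun ω => ((N ω).choose n : ℝ)) P)
    (hmom : ∀ n, ∫ ω, ((N ω).choose n : ℝ) ∂P = e n) (p : ℕ) :
    P.real {ω | p + 1 ≤ N ω} = alternatingTail e p := by
  have hS : MeasurableSet {ω | p + 1 ≤ N ω} := measurableSet_le measurable_const hN
  have hnorm : ∀ i, ∫ ω, ‖(-1 : ℝ) ^ i * ((p + i).choose p * (N ω).choose (p + i + 1))‖ ∂P =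
      (p + i).choose p * e (p + i + 1) := fun i => by
    simp_rw [norm_mul, norm_pow, norm_neg, norm_one, one_pow, one_mul, RCLike.norm_natCast]
    rw [integral_const_mul, hmom]
  have h := hasSum_integral_of_summable_integral_norm (μ := P)
    (F := fun i ω => (-1 : ℝ) ^ i * ((p + i).choose p * (N ω).choose (p + i + 1)))
    (fun i => ((hint _).const_mul _).const_mul _)
    (by simp_rw [hnorm]; exact summable_choose_mul he hs p)
  simp_rw [(hasSum_alternating_choose_mul_choose_succ _ p).tsum_eq, integral_const_mul, hmom] at h
  rw [alternatingTail, h.tsum_eq, ← integral_indicator_one hS]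
  simp [Set.indicator]

/-- If the event were null, $\binom Nm$ would vanish almost surely. Unlike the alternating-series
bounds, this needs no largeness of $m$. -/
theorem measureReal_le_pos [IsFiniteMeasure P]
    (hmom : ∀ n, ∫ ω, ((N ω).choose n : ℝ) ∂P = e n) {m : ℕ} (he : 0 < e m) :
    0 < P.real {ω | m ≤ N ω} := by
  refine lt_of_le_of_ne measureReal_nonneg fun h => ?_
  have h0 : P {ω | m ≤ N ω} = 0 := (measureReal_eq_zero_iff).1 h.symm
  have h1 : ∫ ω, ((N ω).choose m : ℝ) ∂P = 0 := by
    refine integral_eq_zero_of_ae ?_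
    filter_upwards [measure_eq_zero_iff_ae_notMem.1 h0] with ω hω
    rw [Nat.choose_eq_zero_of_lt (by simpa using hω)]
    simp
  exact he.ne' (by rw [← hmom, h1])

end tail

/-! ### Binomial moments of the number of points in a disk. -/

section counting

variable {Ω : Type*} [MeasurableSpace Ω] {P : Measure Ω}

theorem IsPointProcess.exists_nat_count {X : Ω → Measure ℂ} (hX : IsPointProcess X) (a : ℂ)
    (r : ℝ) : ∃ N : Ω → ℕ, Measurable N ∧ ∀ ω, X ω (Metric.ball a r) = N ω := by
  have hex : ∀ ω, ∃ n : ℕ, X ω (Metric.ball a r) = n := fun ω => by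
    obtain ⟨n, hn⟩ := hX.integer_valued ω _ (measurableSet_ball (x := a) (ε := r))
    have hfin : X ω (Metric.ball a r) < ∞ :=
      (measure_mono Metric.ball_subset_closedBall).trans_lt
        (hX.finite_on_compacts ω _ (isCompact_closedBall a r))
    induction n using ENat.recTopCoe with
    | top => simp [hn] at hfin
    | coe n => exact ⟨n, by simpa using hn⟩
  choose N hN using hex
  refine ⟨N, measurable_to_countable' fun n => ?_, hN⟩
  have : N ⁻¹' {n} = (fun ω => X ω (Metric.ball a r)) ⁻¹' {(n : ℝ≥0∞)} := by
    ext ω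
    simp [hN]
  rw [this]
  exact ((Measure.measurable_coe measurableSet_ball).comp hX.measurable) (measurableSet_singleton _)

theorem HasCorrelationFunctions.lintegral_fallingFactorial {E : Type*} [MeasurableSpace E]
    {X : Ω → Measure E} {μ : Measure E} [SigmaFinite μ] {ρ : (n : ℕ) → (Fin n → E) → ℝ≥0}
    (h : HasCorrelationFunctions P X μ ρ) {B : Set E} (hB : MeasurableSet B) {n : ℕ}
    (hn : 1 ≤ n) :
    ∫⁻ ω, fallingFactorial (X ω B) n ∂P =
      ∫⁻ x : Fin n → E, ρ n x ∂(Measure.pi fun _ => μ.restrict B) := by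
  have h1 := h.moments 1 (fun _ => B) (fun _ => n) (fun _ => hB)
    (fun i j hij => (hij (Subsingleton.elim i j)).elim) (by simpa using hn)
  have hset : {x : Fin (∑ _i : Fin 1, n) → E | ∀ i : Fin 1, ∀ j : Fin n,
      x (finSigmaFinEquiv (n := fun _ => n) ⟨i, j⟩) ∈ B} = Set.univ.pi fun _ => B := by
    ext x
    simp only [Set.mem_ofPred_eq, Set.mem_univ_pi]
    refine ⟨fun hx i => ?_, fun hx i j => hx _⟩
    have := hx (finSigmaFinEquiv.symm i).1 (finSigmaFinEquiv.symm i).2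
    simpa using this
  rw [hset] at h1
  -- The moment formula is indexed by `∑ i : Fin 1, n`; generalising this to a variable `k` allows
  -- substitution in the dependent types.
  have hcast : ∀ k, k = n → ∫⁻ x : Fin k → E in Set.univ.pi fun _ => B, (ρ k x : ℝ≥0∞)
      ∂(Measure.pi fun _ => μ) =
      ∫⁻ x : Fin n → E, ρ n x ∂(Measure.pi fun _ => μ.restrict B) := by
    rintro k rfl
    rw [Measure.restrict_pi_pi]
  rw [hcast _ (by simp)] at h1
  simpa using h1

theorem IsGinibreEnsemble.lintegral_choose {X : Ω → Measure ℂ} (hX : IsGinibreEnsemble P X)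
    [IsProbabilityMeasure P] {a : ℂ} {r : ℝ} (hr : 0 < r) {N : Ω → ℕ} (hmeas : Measurable N)
    (hN : ∀ ω, X ω (Metric.ball a r) = N ω) (n : ℕ) :
    ∫⁻ ω, ((N ω).choose n : ℝ≥0∞) ∂P =
      ENNReal.ofReal (esymmSeq (ginibreEigenvalue r) n) := by
  rcases Nat.eq_zero_or_pos n with rfl | hn
  · simp [esymmSeq_zero]
  obtain ⟨-, -, ρ, hρ, hdet⟩ := hX
  have h1 := hρ.lintegral_fallingFactorial (measurableSet_ball (x := a) (ε := r)) hn
  have h2 := integral_det_ginibreKernel a hr n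
  simp_rw [← hdet n hn] at h2
  rw [integral_complex_ofReal, Complex.ofReal_inj] at h2
  have hpos : 0 < esymmSeq (ginibreEigenvalue r) n :=
    (Finset.prod_pos fun k _ => ginibreEigenvalue_pos hr k).trans_le
      (prod_le_esymmSeq (fun k => (ginibreEigenvalue_pos hr k).le) (summable_ginibreEigenvalue hr) n)
  have hint : Integrable (fun x => (ρ n x : ℝ))
      (Measure.pi fun _ : Fin n => volume.restrict (Metric.ball a r)) := by
    -- The Bochner integral of a non-integrable function is $0$ by convention, so the positive value
    -- already computed forces integrability.
    refine Integrable.of_integral_ne_zero ?_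
    rw [h2]
    positivity
  have h3 : ∫⁻ x, (ρ n x : ℝ≥0∞)
      ∂(Measure.pi fun _ : Fin n => volume.restrict (Metric.ball a r)) =
      ENNReal.ofReal (n.factorial * esymmSeq (ginibreEigenvalue r) n) := by
    rw [← h2, ofReal_integral_eq_lintegral_ofReal hint (ae_of_all _ fun x => NNReal.coe_nonneg _)]
    simp
  simp_rw [hN, fallingFactorial_natCast, Nat.cast_mul] at h1
  have hm : Measurable fun ω => ((N ω).choose n : ℝ≥0∞) :=
    (measurable_from_nat (f := fun k => (k.choose n : ℝ≥0∞))).comp hmeas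
  rw [lintegral_mul_const _ hm, h3, ENNReal.ofReal_mul (by positivity), ENNReal.ofReal_natCast, mul_comm] at h1
  exact (ENNReal.mul_right_inj (by simp [n.factorial_ne_zero]) (by simp)).1 h1

theorem IsGinibreEnsemble.integrable_choose {X : Ω → Measure ℂ} (hX : IsGinibreEnsemble P X)
    [IsProbabilityMeasure P] {a : ℂ} {r : ℝ} (hr : 0 < r) {N : Ω → ℕ} (hmeas : Measurable N)
    (hN : ∀ ω, X ω (Metric.ball a r) = N ω) (n : ℕ) :
    Integrable (fun ω => ((N ω).choose n : ℝ)) P := by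
  have hm : Measurable fun ω => ((N ω).choose n : ℝ) :=
    (measurable_from_nat (f := fun k => (k.choose n : ℝ))).comp hmeas
  refine ⟨hm.aestronglyMeasurable, ?_⟩
  rw [hasFiniteIntegral_iff_ofReal (ae_of_all _ fun _ => Nat.cast_nonneg _)]
  simp_rw [ENNReal.ofReal_natCast]
  rw [hX.lintegral_choose hr hmeas hN]
  exact ENNReal.ofReal_lt_top

theorem IsGinibreEnsemble.integral_choose {X : Ω → Measure ℂ} (hX : IsGinibreEnsemble P X)
    [IsProbabilityMeasure P] {a : ℂ} {r : ℝ} (hr : 0 < r) {N : Ω → ℕ} (hmeas : Measurable N)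
    (hN : ∀ ω, X ω (Metric.ball a r) = N ω) (n : ℕ) :
    ∫ ω, ((N ω).choose n : ℝ) ∂P = esymmSeq (ginibreEigenvalue r) n := by
  have hm : Measurable fun ω => ((N ω).choose n : ℝ) :=
    (measurable_from_nat (f := fun k => (k.choose n : ℝ))).comp hmeas
  rw [integral_eq_lintegral_of_nonneg_ae (ae_of_all _ fun _ => Nat.cast_nonneg _)
    hm.aestronglyMeasurable]
  simp_rw [ENNReal.ofReal_natCast]
  rw [hX.lintegral_choose hr hmeas hN, ENNReal.toReal_ofReal]
  exact (Finset.prod_nonneg fun k _ => (ginibreEigenvalue_pos hr k).le).trans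
      (prod_le_esymmSeq (fun k => (ginibreEigenvalue_pos hr k).le) (summable_ginibreEigenvalue hr) n)

end counting

/-! ### Size of the alternating series and logarithmic asymptotics. -/

theorem alternatingTail_bounds {e : ℕ → ℝ} (he : ∀ n, 0 ≤ e n)
    (hs : Summable fun n => 2 ^ n * e n) {p : ℕ}
    (hratio : ∀ n, p + 1 ≤ n → n * e (n + 1) ≤ 1 / 2 * e n) :
    1 / 2 * e (p + 1) ≤ alternatingTail e p ∧ alternatingTail e p ≤ e (p + 1) := by
  set f : ℕ → ℝ := fun i => (p + i).choose p * e (p + i + 1) with hf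
  have hanti : Antitone f := antitone_nat_of_succ_le fun i => by
    have hc : (p + i + 1).choose p ≤ (p + i + 1) * (p + i).choose p := by
      have := Nat.add_one_mul_choose_eq (p + i) i
      rw [show (p + i + 1).choose p = (p + i + 1).choose (i + 1) from
        Nat.choose_symm_of_eq_add (by ring), show (p + i).choose p = (p + i).choose i from
        Nat.choose_symm_of_eq_add (by ring), this]
      exact Nat.le_mul_of_pos_right _ (Nat.succ_pos i)
    have hc' : ((p + i + 1).choose p : ℝ) ≤ (p + i + 1 : ℕ) * (p + i).choose p := by
      exact_mod_cast hc
    have h := hratio (p + i + 1) (by omega)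
    calc f (i + 1) = (p + i + 1).choose p * e (p + i + 1 + 1) := rfl
      _ ≤ (p + i + 1 : ℕ) * (p + i).choose p * e (p + i + 1 + 1) :=
        mul_le_mul_of_nonneg_right hc' (he _)
      _ = (p + i).choose p * ((p + i + 1 : ℕ) * e (p + i + 1 + 1)) := by ring
      _ ≤ (p + i).choose p * e (p + i + 1) :=
        mul_le_mul_of_nonneg_left (h.trans (by linarith [he (p + i + 1)])) (Nat.cast_nonneg _)
  have hlim : Tendsto (fun n => ∑ i ∈ Finset.range n, (-1 : ℝ) ^ i * f i) atTop
      (𝓝 (alternatingTail e p)) := (summable_choose_mul he hs p).tendsto_alternating_series_tsum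
  -- The sum lies between the partial sums with two terms and one term, $e_{p+1}-(p+1)e_{p+2}$ and
  -- $e_{p+1}$.
  have h1 := hanti.alternating_series_le_tendsto hlim 1
  have h2 := hanti.tendsto_le_alternating_series hlim 0
  have h3 := hratio (p + 1) le_rfl
  simp [Finset.sum_range_succ, hf] at h1 h2
  push_cast at h3
  exact ⟨by linarith, h2⟩

theorem sum_log_factorial_le (m : ℕ) :
    ∑ j ∈ Finset.range m, Real.log (j + 1).factorial ≤ 1 / 2 * m ^ 2 * Real.log m + m ^ 2 := by
  rcases Nat.eq_zero_or_pos m with rfl | hm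
  · simp
  have hm0 : (0 : ℝ) < m := by exact_mod_cast hm
  have hlog : 0 ≤ Real.log m := Real.log_natCast_nonneg m
  have hsum : ∑ j ∈ Finset.range m, ((j : ℝ) + 1) = m * (m + 1) / 2 := by
    clear hm hm0 hlog
    induction m with
    | zero => simp
    | succ m ih =>
      rw [Finset.sum_range_succ, ih]
      push_cast
      ring
  calc ∑ j ∈ Finset.range m, Real.log (j + 1).factorial
      ≤ ∑ j ∈ Finset.range m, ((j : ℝ) + 1) * Real.log m := by
        refine Finset.sum_le_sum fun j hj => ?_
        have hj' : j + 1 ≤ m := Finset.mem_range.1 hj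
        have h : ((j + 1).factorial : ℝ) ≤ (m : ℝ) ^ (j + 1) := by
          exact_mod_cast (Nat.factorial_le_pow (j + 1)).trans (Nat.pow_le_pow_left hj' _)
        have := Real.log_le_log (by positivity) h
        rw [Real.log_pow] at this
        exact_mod_cast this
    _ = 1 / 2 * m ^ 2 * Real.log m + 1 / 2 * m * Real.log m := by
        rw [← Finset.sum_mul, hsum]
        ring
    _ ≤ _ := by
        have := Real.log_le_sub_one_of_pos hm0
        nlinarith

theorem le_sum_log_factorial (m : ℕ) :
    1 / 2 * m ^ 2 * Real.log m - m ^ 2 ≤ ∑ j ∈ Finset.range m, Real.log (j + 1).factorial := by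
  induction m with
  | zero => simp
  | succ m ih =>
    rw [Finset.sum_range_succ]
    refine le_trans ?_ (add_le_add_left ih _)
    -- The elementary half of Stirling's formula, from $n^n/n!\le e^n$.
    have hfac : ((m : ℝ) + 1) * Real.log (m + 1) - (m + 1) ≤ Real.log (m + 1).factorial := by
      have h1 : ((m + 1 : ℕ) : ℝ) ^ (m + 1) / (m + 1).factorial ≤ Real.exp (m + 1 : ℕ) :=
        Real.pow_div_factorial_le_exp _ (by positivity) _
      have h2 := Real.log_le_log (by positivity) h1
      rw [Real.log_exp, Real.log_div (by positivity) (by positivity), Real.log_pow] at h2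
      push_cast at h2
      linarith
    have hstep : 1 / 2 * (m : ℝ) ^ 2 * (Real.log (m + 1) - Real.log m) ≤ m / 2 := by
      rcases Nat.eq_zero_or_pos m with rfl | hm
      · simp
      have hm0 : (0 : ℝ) < m := by exact_mod_cast hm
      rw [← Real.log_div (by positivity) hm0.ne']
      have := Real.log_le_sub_one_of_pos (show 0 < ((m : ℝ) + 1) / m by positivity)
      calc _ ≤ 1 / 2 * (m : ℝ) ^ 2 * (((m : ℝ) + 1) / m - 1) := by gcongr
        _ = m / 2 := by field_simp; ring
    have hlog : 0 ≤ Real.log ((m : ℝ) + 1) := Real.log_nonneg (by linarith [m.cast_nonneg (α := ℝ)])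
    push_cast
    nlinarith [m.cast_nonneg (α := ℝ)]

section asymptotics

variable {r : ℝ}

theorem esymmSeq_ginibreEigenvalue_pos (hr : 0 < r) (n : ℕ) :
    0 < esymmSeq (ginibreEigenvalue r) n :=
  (Finset.prod_pos fun k _ => ginibreEigenvalue_pos hr k).trans_le
    (prod_le_esymmSeq (fun k => (ginibreEigenvalue_pos hr k).le) (summable_ginibreEigenvalue hr) n)

/-- The ratio $e_{n+1}/e_n$ is at most the eigenvalue tail from $n$, which is factorially small. The
constant $\frac14$ makes $2^ne_n$ decay with ratio $\frac12$, and also gives the ratio hypothesis of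
`alternatingTail_bounds`. -/
theorem eventually_esymmSeq_ratio (hr : 0 < r) :
    ∀ᶠ n : ℕ in atTop, ((n : ℝ) + 1) * esymmSeq (ginibreEigenvalue r) (n + 1) ≤
      1 / 4 * esymmSeq (ginibreEigenvalue r) n := by
  have h := (FloorSemiring.tendsto_pow_div_factorial_atTop (r ^ 2)).const_mul
    (Real.exp (r ^ 2) * r ^ 2)
  rw [mul_zero] at h
  filter_upwards [h.eventually_le_const (show (0 : ℝ) < 1 / 4 by norm_num)] with n hn
  have h0 := (esymmSeq_ginibreEigenvalue_pos hr n).le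
  calc ((n : ℝ) + 1) * esymmSeq (ginibreEigenvalue r) (n + 1)
      ≤ ((n : ℝ) + 1) * (Real.exp (r ^ 2) * ((r ^ 2) ^ (n + 1) / (n + 1).factorial) *
          esymmSeq (ginibreEigenvalue r) n) := by
        refine mul_le_mul_of_nonneg_left ?_ (by positivity)
        exact (esymmSeq_succ_le (fun k => (ginibreEigenvalue_pos hr k).le)
          (summable_ginibreEigenvalue hr) n).trans
          (mul_le_mul_of_nonneg_right (tsum_ginibreEigenvalue_le hr n) h0)
    _ = Real.exp (r ^ 2) * r ^ 2 * ((r ^ 2) ^ n / n.factorial) *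
          esymmSeq (ginibreEigenvalue r) n := by
        rw [Nat.factorial_succ, pow_succ (r ^ 2) n]
        push_cast
        field_simp
    _ ≤ _ := mul_le_mul_of_nonneg_right hn h0

theorem summable_two_pow_mul_esymmSeq (hr : 0 < r) :
    Summable fun n => 2 ^ n * esymmSeq (ginibreEigenvalue r) n := by
  refine summable_of_ratio_norm_eventually_le (r := 1 / 2) (by norm_num) ?_
  filter_upwards [eventually_esymmSeq_ratio hr] with n hn
  have h0 := esymmSeq_ginibreEigenvalue_pos hr n
  have h1 := esymmSeq_ginibreEigenvalue_pos hr (n + 1)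
  rw [Real.norm_of_nonneg (by positivity), Real.norm_of_nonneg (by positivity), pow_succ]
  have h2 : esymmSeq (ginibreEigenvalue r) (n + 1) ≤ 1 / 4 * esymmSeq (ginibreEigenvalue r) n := by
    nlinarith [n.cast_nonneg (α := ℝ)]
  have h3 : (0 : ℝ) < 2 ^ n := by positivity
  nlinarith

theorem abs_sum_log_pow_div_factorial_le {R : ℝ} (hR : 0 < R) (m : ℕ) :
    |Real.log (∏ j ∈ Finset.range m, R ^ (j + 1) / (j + 1).factorial) +
      1 / 2 * (m : ℝ) ^ 2 * Real.log m| ≤ (|Real.log R| + 1) * m ^ 2 := by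
  have h1 : Real.log (∏ j ∈ Finset.range m, R ^ (j + 1) / (j + 1).factorial) =
      (∑ j ∈ Finset.range m, ((j : ℝ) + 1) * Real.log R) -
        ∑ j ∈ Finset.range m, Real.log (j + 1).factorial := by
    rw [Real.log_prod fun j _ => by positivity, ← Finset.sum_sub_distrib]
    refine Finset.sum_congr rfl fun j _ => ?_
    rw [Real.log_div (by positivity) (by positivity), Real.log_pow]
    push_cast
    rfl
  have h2 : |∑ j ∈ Finset.range m, ((j : ℝ) + 1) * Real.log R| ≤ |Real.log R| * m ^ 2 := by
    refine (Finset.abs_sum_le_sum_abs _ _).trans ?_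
    calc ∑ j ∈ Finset.range m, |((j : ℝ) + 1) * Real.log R|
        ≤ ∑ _j ∈ Finset.range m, m * |Real.log R| := by
          refine Finset.sum_le_sum fun j hj => ?_
          have hj' : (j : ℝ) + 1 ≤ m := by exact_mod_cast Finset.mem_range.1 hj
          rw [abs_mul, abs_of_nonneg (by positivity)]
          gcongr
      _ = _ := by
          rw [Finset.sum_const, Finset.card_range, nsmul_eq_mul]
          ring
  have h3 := sum_log_factorial_le m
  have h4 := le_sum_log_factorial m
  rw [h1]
  rw [abs_le] at h2 ⊢
  constructor <;> linarith [h2.1, h2.2]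

/-- Upper and lower product bounds differ from the same product $A$ only by $e^{\pm r^2m}$, which is
absorbed in $O(m^2)$. -/
theorem abs_log_esymmSeq_le (hr : 0 < r) (m : ℕ) :
    |Real.log (esymmSeq (ginibreEigenvalue r) m) + 1 / 2 * (m : ℝ) ^ 2 * Real.log m| ≤
      (r ^ 2 + |Real.log (r ^ 2)| + 1) * m ^ 2 := by
  have hl := fun k => (ginibreEigenvalue_pos hr k).le
  have hs := summable_ginibreEigenvalue hr
  set A : ℝ := ∏ j ∈ Finset.range m, (r ^ 2) ^ (j + 1) / (j + 1).factorial with hA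
  have hA0 : 0 < A := Finset.prod_pos fun j _ => by positivity
  have hup : esymmSeq (ginibreEigenvalue r) m ≤ Real.exp (r ^ 2) ^ m * A := by
    refine (esymmSeq_le_prod hl hs m).trans ?_
    calc _ ≤ ∏ j ∈ Finset.range m, Real.exp (r ^ 2) * ((r ^ 2) ^ (j + 1) / (j + 1).factorial) :=
          Finset.prod_le_prod (fun j _ => tsum_nonneg fun k => hl _)
            fun j _ => tsum_ginibreEigenvalue_le hr j
      _ = _ := by rw [Finset.prod_mul_distrib, Finset.prod_const, Finset.card_range]
  have hlo : Real.exp (-r ^ 2) ^ m * A ≤ esymmSeq (ginibreEigenvalue r) m := by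
    refine le_trans ?_ (prod_le_esymmSeq hl hs m)
    calc _ = ∏ j ∈ Finset.range m, Real.exp (-r ^ 2) * ((r ^ 2) ^ (j + 1) / (j + 1).factorial) := by
          rw [Finset.prod_mul_distrib, Finset.prod_const, Finset.card_range]
      _ ≤ _ := Finset.prod_le_prod (fun j _ => by positivity) fun j _ => le_ginibreEigenvalue hr j
  have h1 := Real.log_le_log (esymmSeq_ginibreEigenvalue_pos hr m) hup
  have h2 := Real.log_le_log (by positivity) hlo
  rw [Real.log_mul (by positivity) hA0.ne', Real.log_pow, Real.log_exp] at h1 h2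
  have h3 := abs_sum_log_pow_div_factorial_le (show 0 < r ^ 2 by positivity) m
  rw [← hA] at h3
  have hm : (m : ℝ) ≤ (m : ℝ) ^ 2 := by exact_mod_cast Nat.le_self_pow two_ne_zero m
  have h4 : (m : ℝ) * r ^ 2 ≤ r ^ 2 * m ^ 2 := by nlinarith [sq_nonneg r]
  rw [abs_le] at h3 ⊢
  constructor <;> linarith [h3.1, h3.2]

theorem eventually_abs_log_alternatingTail_le (hr : 0 < r) :
    ∀ᶠ m : ℕ in atTop,
      |Real.log (alternatingTail (esymmSeq (ginibreEigenvalue r)) (m - 1)) +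
        1 / 2 * (m : ℝ) ^ 2 * Real.log m| ≤ (r ^ 2 + |Real.log (r ^ 2)| + 2) * m ^ 2 := by
  obtain ⟨n₀, hn₀⟩ := eventually_atTop.1 (eventually_esymmSeq_ratio hr)
  filter_upwards [eventually_ge_atTop n₀, eventually_ge_atTop 1] with m hm hm1
  obtain ⟨p, rfl⟩ : ∃ p, m = p + 1 := ⟨m - 1, by omega⟩
  rw [Nat.add_sub_cancel]
  have hpos := esymmSeq_ginibreEigenvalue_pos hr
  obtain ⟨h1, h2⟩ := alternatingTail_bounds (fun n => (hpos n).le)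
    (summable_two_pow_mul_esymmSeq hr) (p := p) fun n hn => by
      have := hn₀ n (hm.trans hn)
      nlinarith [hpos n, hpos (n + 1)]
  have h3 := Real.log_le_log (by have := hpos (p + 1); positivity) h1
  have h4 := Real.log_le_log ((by have := hpos (p + 1); positivity : (0 : ℝ) <
    1 / 2 * esymmSeq (ginibreEigenvalue r) (p + 1)).trans_le h1) h2
  rw [Real.log_mul (by norm_num) (hpos _).ne', one_div, Real.log_inv] at h3
  have h5 := abs_log_esymmSeq_le hr (p + 1)
  -- The factor $\frac12$ in the lower bound costs $\log2\le1\le m^2$, hence the constant $2$ in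
  -- place of $1$.
  have h6 : Real.log 2 ≤ 1 := by linarith [Real.log_two_lt_d9]
  have h7 : (1 : ℝ) ≤ ((p + 1 : ℕ) : ℝ) ^ 2 := by exact_mod_cast Nat.one_le_pow 2 (p + 1) hm1
  rw [abs_le] at h5 ⊢
  constructor <;> linarith [h5.1, h5.2]

/-- The relative error in the exponent of `ℙ(n_G(a, r) ≥ m) = exp (-(m² log m) / 2 (1 + o(1)))`. -/
noncomputable def ginibreTailError (r : ℝ) (m : ℕ) : ℝ :=
  -2 * Real.log (alternatingTail (esymmSeq (ginibreEigenvalue r)) (m - 1)) /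
    ((m : ℝ) ^ 2 * Real.log m) - 1

theorem tendsto_ginibreTailError (hr : 0 < r) : Tendsto (ginibreTailError r) atTop (𝓝 0) := by
  -- Dividing the $O(m^2)$ error by $\frac12m^2\log m$ leaves $O(1/\log m)$.
  have hlim : Tendsto (fun m : ℕ => 2 * (r ^ 2 + |Real.log (r ^ 2)| + 2) / Real.log m) atTop
      (𝓝 0) := (Real.tendsto_log_atTop.comp tendsto_natCast_atTop_atTop).const_div_atTop _
  refine squeeze_zero_norm' ?_ hlim
  filter_upwards [eventually_abs_log_alternatingTail_le hr, eventually_ge_atTop 2] with m hm hm2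
  have hm0 : (0 : ℝ) < m := by exact_mod_cast (by omega : 0 < m)
  have hlog : 0 < Real.log m := Real.log_pos (by exact_mod_cast hm2)
  set t := Real.log (alternatingTail (esymmSeq (ginibreEigenvalue r)) (m - 1)) with ht
  have h1 : ginibreTailError r m =
      -2 * (t + 1 / 2 * (m : ℝ) ^ 2 * Real.log m) / ((m : ℝ) ^ 2 * Real.log m) := by
    rw [ginibreTailError, ← ht]
    field_simp
    ring
  rw [h1, Real.norm_eq_abs, abs_div, abs_mul, abs_of_pos (show 0 < (m : ℝ) ^ 2 * Real.log m by
    positivity), abs_neg, abs_two, div_le_div_iff₀ (by positivity) hlog]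
  calc _ ≤ 2 * ((r ^ 2 + |Real.log (r ^ 2)| + 2) * m ^ 2) * Real.log m := by gcongr
    _ = _ := by ring

end asymptotics

/-! ### The tail of the disk count. -/

theorem theorem8p3 (r : ℝ) (hr : 0 < r) :
    ∃ ε : ℕ → ℝ, Tendsto ε atTop (𝓝 0) ∧
      ∀ (Ω : Type*) [MeasurableSpace Ω] (P : Measure Ω) [IsProbabilityMeasure P]
        (X : Ω → Measure ℂ), IsGinibreEnsemble P X →
        ∀ (a : ℂ) (m : ℕ), 2 ≤ m →
          P.real {ω | (m : ℝ≥0∞) ≤ X ω (Metric.ball a r)} =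
            Real.exp (-(1 / 2) * (m : ℝ) ^ 2 * Real.log m * (1 + ε m)) := by
  -- The tail probability is an explicit series in $r$ alone, so solving the claimed identity for
  -- $\varepsilon_m$ gives an error independent of the probability space, the process and the
  -- centre. Here $m\ge2$ keeps $\log m$ nonzero.
  refine ⟨ginibreTailError r, tendsto_ginibreTailError hr, ?_⟩
  intro Ω _ P _ X hX a m hm
  obtain ⟨N, hmeas, hN⟩ := hX.1.exists_nat_count a r
  have hmom := hX.integral_choose hr hmeas hN
  have hpos := esymmSeq_ginibreEigenvalue_pos hr
  have htail := measureReal_le_eq_alternatingTail hmeas (fun n => (hpos n).le)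
    (summable_two_pow_mul_esymmSeq hr) (hX.integrable_choose hr hmeas hN) hmom (m - 1)
  rw [Nat.sub_add_cancel (by omega)] at htail
  have hP := measureReal_le_pos hmom (hpos m)
  have hlog : 0 < Real.log m := Real.log_pos (by exact_mod_cast hm)
  have hm0 : (0 : ℝ) < m := by exact_mod_cast (by omega : 0 < m)
  have hexp : -(1 / 2) * (m : ℝ) ^ 2 * Real.log m * (1 + ginibreTailError r m) =
      Real.log (P.real {ω | m ≤ N ω}) := by
    rw [ginibreTailError, htail]
    field_simp
    ring
  rw [hexp, Real.exp_log hP]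
  simp_rw [hN, Nat.cast_le]
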